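/- For a prime power $q$ let $\mathbb F_q$ be the finite field with $q$ elements. For integers $n\ge 2$ let $$\delta^{\mathrm{rk}}_q(n\times n,2,n)=\frac{\bigl|\{\mathcal C\le\mathbb F_q^{n\times n}\mid \dim_{\mathbb F_q}\mathcal C=2,\ d^{\mathrm{rk}}(\mathcal C)\ge n\}\bigr|}{\binom{n^2}{2}_q},\qquad \binom{n^2}{2}_q=\prod_{\ell=0}^{1}\frac{q^{n^2}-q^\ell}{q^2-q^\ell},$$ where $d^{\mathrm{rk}}(\mathcal C)=\min\{\mathrm{rk}(M)\mid M\in\mathcal C,\ M\ne 0\}$; this is the proportion, among the $2$-dimensional $\mathbb F_q$-subspaces of $\mathbb F_q^{n\times n}$, of those all of whose non-zero elements are invertible. Let $s_q(n)$ be the number of spectrum-free matrices in $\mathbb F_q^{n\times n}$, i.e. of matrices $M\in\mathbb F_q^{n\times n}$ such that no element of $\mathbb F_q$ is an eigenvalue of $M$. Then, for every prime power $q$ and every integer $n\ge 2$, $$\delta^{\mathrm{rk}}_q(n\times n,2,n)=\frac{s_q(n)\prod_{i=0}^{n-1}(q^n-q^i)}{(q^{n^2}-1)(q^{n^2}-q)}.$$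 Moreover, for every fixed integer $n\ge 2$, with $q$ running over the prime powers, $$\lim_{q\to+\infty}\delta^{\mathrm{rk}}_q(n\times n,2,n)=\sum_{i=0}^n\frac{(-1)^i}{i!},$$ and for every fixed prime power $q$, $$\lim_{n\to+\infty}\delta^{\mathrm{rk}}_q(n\times n,2,n)=\prod_{i=1}^{\infty}\left(1-\frac1{q^i}\right)^{q+1},$$ where the infinite product converges. -/

import Mathlib

open Filter Topology

noncomputable section

/-- The minimum (rank) distance of a rank-metric code `C`: the minimum of the ranks of its
non-zero elements. It is used for non-zero `C` only, where the minimum is attained. -/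
def minRankDist {K : Type*} [Field K] {n m : ℕ}
    (C : Submodule K (Matrix (Fin n) (Fin m) K)) : ℕ :=
  sInf {r : ℕ | ∃ M ∈ C, M ≠ 0 ∧ M.rank = r}

/-- The `q`-binomial coefficient of `i ≥ j`, as a real number. -/
def qBinom (q i j : ℕ) : ℝ :=
  ∏ l ∈ Finset.range j, (((q : ℝ) ^ i - (q : ℝ) ^ l) / ((q : ℝ) ^ j - (q : ℝ) ^ l))

/-- The set of rank-metric codes (non-zero subspaces) in `K^{n × m}` of dimension `k` and
minimum distance at least `d`. -/
def rankCodes (K : Type*) [Field K] (n m k d : ℕ) :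
    Set (Submodule K (Matrix (Fin n) (Fin m) K)) :=
  {C | C ≠ ⊥ ∧ Module.finrank K C = k ∧ d ≤ minRankDist C}

/-- The density of the rank-metric codes in `K^{n × m}` of dimension `k` and minimum distance at
least `d` among all subspaces of dimension `k`, for a finite field `K`. -/
def rankDensity (K : Type*) [Field K] (n m k d : ℕ) : ℝ :=
  ((rankCodes K n m k d).ncard : ℝ) / qBinom (Nat.card K) (m * n) k

/-- The number of spectrum-free `m × m` matrices over a finite field `K`, that is, those for
which no element of `K` is an eigenvalue. -/
def numSpectrumFree (K : Type*) [Field K] (m : ℕ) : ℕ :=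
  {M : Matrix (Fin m) (Fin m) K |
    ∀ a : K, ¬ Module.End.HasEigenvalue (Matrix.toLin' M) a}.ncard

end

/-! A basis `(A, B)` spans a code of invertible matrices exactly when `A` is invertible and `A⁻¹B`
is spectrum-free. Counting bases in two ways (`ncard_rankCodes_two_mul`) gives the exact formula,
and the limits reduce to the asymptotics of `s_q(n) / q^(n^2)`.

Write `E(u) = ∏ r ≥ 1, (1 - u / q^r)`, with coefficients `e_k`. By `sum_eulerCoeff_mul_prod_pow`,
weighting the number of independent `k`-tuples in a space by `e_k` and summing over `k` detects the
zero space. The product of these sums over all eigenspaces of `f` is therefore the indicator of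
spectrum-freeness. After expansion and interchange of sums, one counts endomorphisms with prescribed
scalar action on an independent family, and only the size of the family matters. Hence `s_q(n) /
q^(n^2) = ∑ j ≤ n, indepProb q n j * [u^j] E(u)^q` (`numSpectrumFree_eq`).

For `n → ∞` the weights tend to 1 and dominated convergence gives `E(1)^q`; the factor `|GL_n| /
q^(n^2)` contributes one more `E(1)`. For `q → ∞` the coefficients of `E^q` tend to those of
`exp(-u)`, by a recurrence from the logarithmic derivative. -/

/-! ### Euler's product as a power series. -/

/-- The coefficients of Euler's product `∏ r ≥ 1, (1 - u / q ^ r)` as a power series in `u`. -/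
noncomputable def eulerCoeff (q : ℝ) (k : ℕ) : ℝ :=
  (-1) ^ k / ∏ i ∈ Finset.range k, (q ^ (i + 1) - 1)

/-- Euler's product `∏ r ≥ 1, (1 - u / q ^ r)` as a formal power series in `u`. -/
noncomputable def eulerSeries (q : ℝ) : PowerSeries ℝ := PowerSeries.mk (eulerCoeff q)

/-- The probability that `j` uniformly random vectors of `𝔽_q ^ n` are linearly independent. -/
noncomputable def indepProb (q : ℝ) (n j : ℕ) : ℝ :=
  ∏ i ∈ Finset.range j, (1 - q ^ i / q ^ n)

@[simp] lemma eulerCoeff_zero (q : ℝ) : eulerCoeff q 0 = 1 := by simp [eulerCoeff]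

lemma eulerCoeff_succ (q : ℝ) (k : ℕ) :
    eulerCoeff q (k + 1) = -eulerCoeff q k / (q ^ (k + 1) - 1) := by
  simp only [eulerCoeff, Finset.prod_range_succ, pow_succ (-1 : ℝ) k, div_div, neg_div',
    mul_neg, mul_one]

lemma pow_succ_sub_one_pos {q : ℝ} (hq : 1 < q) (k : ℕ) : 0 < q ^ (k + 1) - 1 :=
  sub_pos.2 (one_lt_pow₀ hq k.succ_ne_zero)

lemma eulerCoeff_ne_zero {q : ℝ} (hq : 1 < q) (k : ℕ) : eulerCoeff q k ≠ 0 :=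
  div_ne_zero (by simp) (Finset.prod_ne_zero_iff.2 fun i _ => (pow_succ_sub_one_pos hq i).ne')

/-- The closed form survives each new term because `(q^(m+1) - 1) + (1 - x) = q^(m+1) - x`. It
exhibits the zeros `q, ..., q^m` of the polynomial and its value 1 at `x = 1`. -/
lemma sum_eulerCoeff_mul_prod {q : ℝ} (hq : 1 < q) (x : ℝ) (m : ℕ) :
    ∑ k ∈ Finset.range (m + 1), eulerCoeff q k * ∏ i ∈ Finset.range k, (x - q ^ i) =
      ∏ i ∈ Finset.range m, ((q ^ (i + 1) - x) / (q ^ (i + 1) - 1)) := by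
  induction m with
  | zero => simp
  | succ m ih =>
    have h : ∀ k, eulerCoeff q k * ∏ i ∈ Finset.range k, (x - q ^ i) =
        (∏ i ∈ Finset.range k, (q ^ i - x)) / ∏ i ∈ Finset.range k, (q ^ (i + 1) - 1) := by
      intro k
      rw [eulerCoeff, div_mul_eq_mul_div]
      congr 1
      rw [← Finset.card_range k, ← Finset.prod_const, Finset.card_range,
        ← Finset.prod_mul_distrib]
      exact Finset.prod_congr rfl fun i _ => by ring
    have hm := (pow_succ_sub_one_pos hq m).ne'
    have hP : ∏ i ∈ Finset.range m, (q ^ (i + 1) - 1) ≠ 0 :=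
      Finset.prod_ne_zero_iff.2 fun i _ => (pow_succ_sub_one_pos hq i).ne'
    rw [Finset.sum_range_succ, ih, h, Finset.prod_div_distrib, Finset.prod_div_distrib,
      Finset.prod_range_succ' (fun i => q ^ i - x),
      Finset.prod_range_succ (fun i => q ^ (i + 1) - 1) m,
      Finset.prod_range_succ (fun i => q ^ (i + 1) - x) m]
    field_simp
    ring

/-- Möbius inversion for subspaces: for `q` the field size, the inner product counts independent
`k`-tuples in dimension `d`. -/
lemma sum_eulerCoeff_mul_prod_pow {q : ℝ} (hq : 1 < q) {d n : ℕ} (hd : d ≤ n) :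
    ∑ k ∈ Finset.range (n + 1), eulerCoeff q k * ∏ i ∈ Finset.range k, (q ^ d - q ^ i) =
      if d = 0 then 1 else 0 := by
  rw [sum_eulerCoeff_mul_prod hq]
  split_ifs with h
  · subst h
    exact Finset.prod_eq_one fun i _ => by
      rw [pow_zero, div_self (pow_succ_sub_one_pos hq i).ne']
  · obtain ⟨d, rfl⟩ := Nat.exists_eq_succ_of_ne_zero h
    exact Finset.prod_eq_zero (Finset.mem_range.2 (Nat.lt_of_succ_le hd)) (by simp)

lemma summable_norm_eulerCoeff {q : ℝ} (hq : 1 < q) : Summable fun k => ‖eulerCoeff q k‖ := by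
  refine summable_of_ratio_test_tendsto_lt_one (l := 0) one_pos
    (Eventually.of_forall fun k => norm_ne_zero_iff.2 (eulerCoeff_ne_zero hq k)) ?_
  have h : ∀ k, ‖‖eulerCoeff q (k + 1)‖‖ / ‖‖eulerCoeff q k‖‖ = (q ^ (k + 1) - 1)⁻¹ := by
    intro k
    have := norm_ne_zero_iff.2 (eulerCoeff_ne_zero hq k)
    have h2 := pow_succ_sub_one_pos hq k
    rw [norm_norm, norm_norm, eulerCoeff_succ, norm_div, norm_neg, Real.norm_of_nonneg h2.le]
    field_simp
  simp_rw [h]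
  have := (tendsto_pow_atTop_atTop_of_one_lt hq).comp (tendsto_add_atTop_nat 1)
  exact (tendsto_atTop_add_const_right _ (-1) this).inv_tendsto_atTop

/-- The functional equation `E(qx) = (1 - x) E(x)`, read off from the recurrence of the
coefficients. -/
lemma tsum_eulerCoeff_mul_pow {q : ℝ} (hq : 1 < q) {x : ℝ} (hx : |q * x| ≤ 1) :
    ∑' k, eulerCoeff q k * (q * x) ^ k = (1 - x) * ∑' k, eulerCoeff q k * x ^ k := by
  have hs : ∀ y : ℝ, |y| ≤ 1 → Summable fun k => eulerCoeff q k * y ^ k := fun y hy =>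
    Summable.of_norm_bounded (summable_norm_eulerCoeff hq) fun k => by
      rw [norm_mul, norm_pow]
      exact mul_le_of_le_one_right (norm_nonneg _) (pow_le_one₀ (norm_nonneg _) hy)
  have hx' : |x| ≤ 1 := by
    rw [abs_mul, abs_of_pos (by linarith)] at hx
    nlinarith [abs_nonneg x]
  have h1 := hs _ hx
  have h2 := hs _ hx'
  have h3 : ∀ k, eulerCoeff q (k + 1) * (q * x) ^ (k + 1) =
      eulerCoeff q (k + 1) * x ^ (k + 1) - x * (eulerCoeff q k * x ^ k) := fun k => by
    have := pow_succ_sub_one_pos hq k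
    rw [eulerCoeff_succ]
    field_simp
    ring
  have h4 := h2.tsum_eq_zero_add
  rw [h1.tsum_eq_zero_add]
  simp_rw [h3]
  rw [((summable_nat_add_iff 1).2 h2).tsum_sub (h2.mul_left x), tsum_mul_left]
  simp only [pow_zero] at h4 ⊢
  linear_combination -h4

/-- Iterating the functional equation moves the argument from 1 to `q^(-n)` and splits off `n`
factors of the product; the remaining `E(q^(-n))` tends to `E(0) = 1`. -/
lemma tendsto_prod_tsum_eulerCoeff {q : ℝ} (hq : 1 < q) :
    Tendsto (fun n => ∏ i ∈ Finset.range n, (1 - 1 / q ^ (i + 1))) atTop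
      (𝓝 (∑' k, eulerCoeff q k)) := by
  have h : ∀ n, ∑' k, eulerCoeff q k =
      (∏ i ∈ Finset.range n, (1 - 1 / q ^ (i + 1))) * ∑' k, eulerCoeff q k * (1 / q ^ n) ^ k := by
    intro n
    induction n with
    | zero => simp
    | succ n ih =>
      have hp : (0 : ℝ) < q ^ n := by positivity
      have hx : 1 / q ^ n = q * (1 / q ^ (n + 1)) := by
        field_simp
        ring
      have hle : |q * (1 / q ^ (n + 1))| ≤ 1 := by
        rw [← hx, abs_of_pos (by positivity), div_le_one hp]
        exact one_le_pow₀ hq.le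
      rw [ih, Finset.prod_range_succ, hx, tsum_eulerCoeff_mul_pow hq hle, mul_assoc]
  have hlim : Tendsto (fun n : ℕ => ∑' k, eulerCoeff q k * (1 / q ^ n) ^ k) atTop (𝓝 1) := by
    have h1 : ∑' k, eulerCoeff q k * (0 : ℝ) ^ k = 1 := by
      rw [tsum_eq_single 0 fun k hk => by simp [hk]]
      simp
    suffices h2 : Tendsto (fun n : ℕ => ∑' k, eulerCoeff q k * (1 / q ^ n) ^ k) atTop
        (𝓝 (∑' k, eulerCoeff q k * (0 : ℝ) ^ k)) by rwa [h1] at h2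
    refine tendsto_tsum_of_dominated_convergence (summable_norm_eulerCoeff hq) (fun k => ?_)
      (Eventually.of_forall fun n k => ?_)
    · exact ((tendsto_const_nhds.div_atTop
        (tendsto_pow_atTop_atTop_of_one_lt hq)).pow k).const_mul _
    · rw [norm_mul, norm_pow]
      refine mul_le_of_le_one_right (norm_nonneg _) (pow_le_one₀ (norm_nonneg _) ?_)
      rw [Real.norm_of_nonneg (by positivity), div_le_one (by positivity)]
      exact one_le_pow₀ hq.le
  have h2 := (tendsto_const_nhds (x := ∑' k, eulerCoeff q k)).div hlim one_ne_zero
  rw [div_one] at h2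
  refine h2.congr' ?_
  filter_upwards [hlim.eventually_ne one_ne_zero] with n hn
  rw [Pi.div_apply, h n, mul_div_cancel_right₀ _ hn]

/-- Cauchy products of absolutely convergent series: evaluation at `u = 1` commutes with powers. -/
lemma eulerSeries_pow_summable {q : ℝ} (hq : 1 < q) (m : ℕ) :
    (Summable fun j => ‖PowerSeries.coeff j (eulerSeries q ^ m)‖) ∧
      ∑' j, PowerSeries.coeff j (eulerSeries q ^ m) = (∑' k, eulerCoeff q k) ^ m := by
  induction m with
  | zero =>
    have h : ∀ j, j ≠ 0 → PowerSeries.coeff j (1 : PowerSeries ℝ) = 0 := fun j hj => by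
      simp [PowerSeries.coeff_one, hj]
    refine ⟨summable_of_ne_finset_zero (s := {0}) fun j hj => ?_, ?_⟩
    · rw [pow_zero, h j (by simpa using hj), norm_zero]
    · rw [pow_zero, pow_zero, tsum_eq_single 0 h]
      simp
  | succ m ih =>
    have he := summable_norm_eulerCoeff hq
    have hc : (fun j => PowerSeries.coeff j (eulerSeries q ^ (m + 1))) = fun j =>
        ∑ kl ∈ Finset.HasAntidiagonal.antidiagonal j,
          PowerSeries.coeff kl.1 (eulerSeries q ^ m) * eulerCoeff q kl.2 := funext fun j => by
      simp only [pow_succ, PowerSeries.coeff_mul, eulerSeries, PowerSeries.coeff_mk]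
    have h1 := summable_norm_sum_mul_antidiagonal_of_summable_norm ih.1 he
    have h2 := tsum_mul_tsum_eq_tsum_sum_antidiagonal_of_summable_norm ih.1 he
    exact ⟨h1.congr fun j => congrArg norm (congrFun hc j).symm,
      by rw [hc, ← h2, ih.2, ← pow_succ]⟩

/-! ### Independence probabilities as the dimension grows. -/

lemma indepProb_eq_zero {q : ℝ} (hq : 1 < q) {n j : ℕ} (h : n < j) : indepProb q n j = 0 :=
  Finset.prod_eq_zero (Finset.mem_range.2 h) (by
    rw [div_self (pow_pos (by linarith) n).ne', sub_self])

lemma abs_indepProb_le_one {q : ℝ} (hq : 1 < q) (n j : ℕ) : |indepProb q n j| ≤ 1 := by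
  rcases lt_or_ge n j with h | h
  · simp [indepProb_eq_zero hq h]
  · rw [indepProb, Finset.abs_prod]
    refine Finset.prod_le_one (fun _ _ => abs_nonneg _) fun i hi => ?_
    have h0 : (0 : ℝ) < q := by linarith
    have h1 : q ^ i / q ^ n ≤ 1 := div_le_one_of_le₀
      (pow_le_pow_right₀ hq.le ((Finset.mem_range.1 hi).le.trans h)) (by positivity)
    have h2 : 0 ≤ q ^ i / q ^ n := by positivity
    rw [abs_le]
    constructor <;> linarith

lemma tendsto_indepProb {q : ℝ} (hq : 1 < q) (j : ℕ) :
    Tendsto (fun n => indepProb q n j) atTop (𝓝 1) := by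
  have : Tendsto (fun n => indepProb q n j) atTop (𝓝 (∏ i ∈ Finset.range j, (1 - 0))) := by
    refine tendsto_finsetProd _ fun i _ => tendsto_const_nhds.sub ?_
    exact tendsto_const_nhds.div_atTop (tendsto_pow_atTop_atTop_of_one_lt hq)
  simpa using this

lemma tendsto_sum_indepProb_mul {q : ℝ} (hq : 1 < q) {c : ℕ → ℝ} (hc : Summable fun j => ‖c j‖) :
    Tendsto (fun n => ∑ j ∈ Finset.range (n + 1), indepProb q n j * c j) atTop
      (𝓝 (∑' j, c j)) := by
  have h : ∀ n, ∑ j ∈ Finset.range (n + 1), indepProb q n j * c j = ∑' j, indepProb q n j * c j :=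
    fun n => (tsum_eq_sum fun j hj => by
      rw [indepProb_eq_zero hq (by simpa [Nat.lt_succ_iff] using hj), zero_mul]).symm
  simp_rw [h]
  refine tendsto_tsum_of_dominated_convergence hc (fun j => ?_) (Eventually.of_forall fun n j => ?_)
  · simpa using (tendsto_indepProb hq j).mul_const (c j)
  · rw [norm_mul]
    exact mul_le_of_le_one_left (norm_nonneg _) (abs_indepProb_le_one hq n j)

/-! ### Coefficients as the field grows. -/

section FieldSizeLimit

variable {α : Type*} {l : Filter α} {q : α → ℝ}

lemma tendsto_pow_succ_sub_one (hq : Tendsto q l atTop) (k : ℕ) :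
    Tendsto (fun x => q x ^ (k + 1) - 1) l atTop :=
  tendsto_atTop_add_const_right _ (-1) ((tendsto_pow_atTop k.succ_ne_zero).comp hq)

lemma tendsto_eulerCoeff (hq : Tendsto q l atTop) (k : ℕ) :
    Tendsto (fun x => eulerCoeff (q x) k) l (𝓝 (if k = 0 then 1 else 0)) := by
  induction k with
  | zero => simpa using tendsto_const_nhds
  | succ k ih =>
    simp_rw [eulerCoeff_succ]
    simpa using ih.neg.div_atTop (tendsto_pow_succ_sub_one hq k)

lemma tendsto_mul_eulerCoeff_succ (hq : Tendsto q l atTop) (k : ℕ) :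
    Tendsto (fun x => q x * eulerCoeff (q x) (k + 1)) l (𝓝 (if k = 0 then -1 else 0)) := by
  have h0 : Tendsto (fun x => q x / (q x ^ (k + 1) - 1)) l (𝓝 (if k = 0 then 1 else 0)) := by
    have h1 : Tendsto (fun x => 1 + 1 / (q x - 1)) l (𝓝 (1 + 0)) :=
      tendsto_const_nhds.add (tendsto_const_nhds.div_atTop
        (tendsto_atTop_add_const_right _ (-1) hq))
    cases k with
    | zero =>
      rw [add_zero] at h1
      refine h1.congr' ?_
      filter_upwards [hq.eventually_gt_atTop 1] with x hx
      have : q x - 1 ≠ 0 := by linarith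
      simp only [zero_add, pow_one]
      field_simp
      ring
    | succ k =>
      have h2 : Tendsto (fun x => q x ^ (k + 1) - (q x)⁻¹) l atTop :=
        ((tendsto_pow_atTop k.succ_ne_zero).comp hq).atTop_add hq.inv_tendsto_atTop.neg
      simp only [Nat.add_eq_zero_iff, one_ne_zero, and_false, if_false]
      refine h2.inv_tendsto_atTop.congr' ?_
      filter_upwards [hq.eventually_gt_atTop 1] with x hx
      have h3 : q x ≠ 0 := by linarith
      have h4 := (pow_succ_sub_one_pos hx (k + 1)).ne'
      have h5 : q x ^ (k + 1) - (q x)⁻¹ = (q x ^ (k + 1 + 1) - 1) / q x := by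
        field_simp
        ring
      rw [Pi.inv_apply, h5, inv_div]
  have h := ((tendsto_eulerCoeff hq k).mul h0).neg
  refine (h.congr fun x => ?_).trans_eq ?_
  · rw [eulerCoeff_succ]; ring
  · split_ifs <;> simp

end FieldSizeLimit

/-- Compare coefficients in `(f^m)' f = m f^m f'` and isolate the top one, whose factor is the
constant term 1. The exponent `m` stays attached to a coefficient of `f` because, for `m = q`, only
that product has a useful limit. -/
lemma coeff_pow_succ_mul (f : PowerSeries ℝ) (hf : PowerSeries.constantCoeff f = 1) (m j : ℕ) :
    PowerSeries.coeff (j + 1) (f ^ m) * (j + 1) =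
      (∑ kl ∈ Finset.HasAntidiagonal.antidiagonal j, PowerSeries.coeff kl.1 (f ^ m) *
        ((m * PowerSeries.coeff (kl.2 + 1) f) * (kl.2 + 1))) -
      ∑ kl ∈ Finset.HasAntidiagonal.antidiagonal j, if kl.2 = 0 then 0 else
        PowerSeries.coeff (kl.1 + 1) (f ^ m) * (kl.1 + 1) * PowerSeries.coeff kl.2 f := by
  have h : PowerSeries.derivative ℝ (f ^ m) * f =
      f ^ m * ((m : PowerSeries ℝ) * PowerSeries.derivative ℝ f) := by
    rw [PowerSeries.derivative_pow]
    cases m with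
    | zero => simp
    | succ m => rw [Nat.add_sub_cancel]; ring
  have h1 := congrArg (PowerSeries.coeff j) h
  rw [PowerSeries.coeff_mul, PowerSeries.coeff_mul] at h1
  simp only [PowerSeries.coeff_derivative] at h1
  have hm : ∀ k, PowerSeries.coeff k ((m : PowerSeries ℝ) * PowerSeries.derivative ℝ f) =
      m * PowerSeries.coeff (k + 1) f * (k + 1) := fun k => by
    rw [← map_natCast (PowerSeries.C (R := ℝ)), PowerSeries.coeff_C_mul,
      PowerSeries.coeff_derivative, mul_assoc]
  simp only [hm] at h1
  rw [← h1, ← Finset.sum_sub_distrib, Finset.sum_eq_single (j, 0)]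
  · simp [hf]
  · rintro ⟨a, b⟩ hab hne
    have : b ≠ 0 := by
      rintro rfl
      exact hne (by simpa using hab)
    simp [this]
  · simp

/-- Base and exponent grow together. Since `q e_1 → -1` while `q e_k → 0` for `k ≥ 2`, the
recurrence becomes `(j + 1) c_(j+1) = -c_j` in the limit. -/
lemma tendsto_coeff_eulerSeries_pow {α : Type*} {l : Filter α} {q : α → ℕ}
    (hq : Tendsto (fun x => (q x : ℝ)) l atTop) (j : ℕ) :
    Tendsto (fun x => PowerSeries.coeff j (eulerSeries (q x) ^ q x)) l
      (𝓝 ((-1) ^ j / (j.factorial : ℝ))) := by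
  have h0 : ∀ x, PowerSeries.constantCoeff (eulerSeries x) = 1 := fun x => by
    simp [eulerSeries, ← PowerSeries.coeff_zero_eq_constantCoeff_apply]
  induction j using Nat.strong_induction_on with
  | _ j ih =>
    cases j with
    | zero => simpa [h0] using tendsto_const_nhds
    | succ j =>
      have hj : (j + 1 : ℝ) ≠ 0 := by positivity
      have key : Tendsto (fun x => PowerSeries.coeff (j + 1) (eulerSeries (q x) ^ q x) *
          ((j : ℝ) + 1)) l (𝓝 ((∑ kl ∈ Finset.HasAntidiagonal.antidiagonal j,
            (-1) ^ kl.1 / (kl.1.factorial : ℝ) * ((if kl.2 = 0 then -1 else 0) * (kl.2 + 1))) -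
            ∑ kl ∈ Finset.HasAntidiagonal.antidiagonal j, 0)) := by
        refine Tendsto.congr (fun x => (coeff_pow_succ_mul _ (h0 _) (q x) j).symm) ?_
        refine Tendsto.sub (tendsto_finsetSum _ fun kl hkl => ?_)
          (tendsto_finsetSum _ fun kl hkl => ?_)
        · have := Finset.HasAntidiagonal.mem_antidiagonal.1 hkl
          refine (ih kl.1 (by omega)).mul (Tendsto.mul_const _ ?_)
          simpa [eulerSeries] using tendsto_mul_eulerCoeff_succ hq kl.2
        · have := Finset.HasAntidiagonal.mem_antidiagonal.1 hkl
          split_ifs with hb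
          · exact tendsto_const_nhds
          · have h1 := ((ih (kl.1 + 1) (by omega)).mul_const ((kl.1 : ℝ) + 1)).mul
              (tendsto_eulerCoeff hq kl.2)
            simpa [eulerSeries, hb] using h1
      have h2 := key.div_const ((j : ℝ) + 1)
      refine (h2.congr fun x => mul_div_cancel_right₀ _ hj).trans_eq ?_
      rw [Finset.sum_eq_single (j, 0)]
      · simp [Nat.factorial_succ, pow_succ]
        field_simp
      · rintro ⟨a, b⟩ hab hne
        have : b ≠ 0 := by
          rintro rfl
          exact hne (by simpa using hab)
        simp [this]
      · simp

/-! ### Grouping exponent tuples by their total. -/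

/-- Truncating each factor at degree `d` loses nothing: coefficients up to `d` are unaffected, and
`indepProb` kills larger totals. -/
lemma sum_piFinset_eulerCoeff {ι : Type*} [Fintype ι] [DecidableEq ι] {q : ℝ} (hq : 1 < q) (d : ℕ) :
    ∑ k ∈ Fintype.piFinset fun _ : ι => Finset.range (d + 1),
      (∏ a, eulerCoeff q (k a)) * indepProb q d (∑ a, k a) =
    ∑ j ∈ Finset.range (d + 1),
      indepProb q d j * PowerSeries.coeff j (eulerSeries q ^ Nat.card ι) := by
  have h1 : (PowerSeries.trunc (d + 1) (eulerSeries q)) ^ Nat.card ι =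
      ∑ k ∈ Fintype.piFinset fun _ : ι => Finset.range (d + 1),
        Polynomial.monomial (∑ a, k a) (∏ a, eulerCoeff q (k a)) := by
    rw [Nat.card_eq_fintype_card, ← Finset.card_univ, ← Finset.prod_const, PowerSeries.trunc_apply,
      ← Finset.range_eq_Ico, Finset.prod_univ_sum]
    refine Finset.sum_congr rfl fun k _ => ?_
    simp only [eulerSeries, PowerSeries.coeff_mk, ← Polynomial.C_mul_X_pow_eq_monomial]
    rw [Finset.prod_mul_distrib, Finset.prod_pow_eq_pow_sum, map_prod]
  have h2 : ∀ j ∈ Finset.range (d + 1), PowerSeries.coeff j (eulerSeries q ^ Nat.card ι) =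
      ∑ k ∈ Fintype.piFinset fun _ : ι => Finset.range (d + 1),
        if ∑ a, k a = j then ∏ a, eulerCoeff q (k a) else 0 := fun j hj => by
    have h3 := congrArg (Polynomial.coeff · j)
      (PowerSeries.trunc_trunc_pow (eulerSeries q) (d + 1) (Nat.card ι))
    simp only [PowerSeries.coeff_trunc, if_pos (Finset.mem_range.1 hj)] at h3
    rw [← h3, ← Polynomial.coe_pow, Polynomial.coeff_coe, h1, Polynomial.finsetSum_coeff]
    simp only [Polynomial.coeff_monomial]
  have h3 := Finset.sum_congr (rfl : Finset.range (d + 1) = _) fun j hj =>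
    (congrArg (indepProb q d j * ·) (h2 j hj)).trans (Finset.mul_sum _ _ _)
  rw [h3, Finset.sum_comm]
  refine Finset.sum_congr rfl fun k _ => ?_
  simp only [mul_ite, mul_zero]
  rw [Finset.sum_ite_eq]
  split_ifs with h
  · ring
  · rw [indepProb_eq_zero hq (by simpa [Nat.lt_succ_iff] using h), mul_zero]

/-! ### Counting spectrum-free endomorphisms. -/

section LinearAlgebraCounting

variable {K V : Type*} [Field K] [AddCommGroup V] [Module K V]

lemma LinearIndependent.exists_linearMap_apply_eq {ι : Type*} {s : ι → V}
    (hs : LinearIndependent K s) (w : ι → V) : ∃ f : V →ₗ[K] V, ∀ i, f (s i) = w i := by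
  obtain ⟨g, hg⟩ := LinearMap.exists_extend ((Module.Basis.span hs).constr K w)
  refine ⟨g, fun i => ?_⟩
  have h := LinearMap.congr_fun hg (Module.Basis.span hs i)
  rw [Module.Basis.constr_basis, LinearMap.comp_apply, Submodule.subtype_apply,
    Module.Basis.span_apply] at h
  exact h

lemma linearIndependent_sigma_eigenspace {ι : K → Type*} (f : Module.End K V)
    {s : ∀ a, ι a → f.eigenspace a} (hs : ∀ a, LinearIndependent K (s a)) :
    LinearIndependent K fun i : Σ a, ι a => (s i.1 i.2 : V) := by
  refine linearIndependent_iUnion_finite (f := fun a i => (s a i : V))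
    (fun a => (hs a).map' _ (Submodule.ker_subtype _)) fun a t _ hat => ?_
  have hle : ∀ b, Submodule.span K (Set.range fun i => (s b i : V)) ≤ f.eigenspace b := fun b =>
    Submodule.span_le.2 (Set.range_subset_iff.2 fun i => (s b i).2)
  exact (f.eigenspaces_iSupIndep.disjoint_biSup hat).mono (hle a)
    (iSup₂_mono fun b _ => hle b)

variable [Finite V]

/-- Evaluation on an independent family is a surjective linear map, so all its fibres have the size
of its kernel. -/
lemma card_linearMap_apply_eq {ι : Type*} [Fintype ι] {s : ι → V}
    (hs : LinearIndependent K s) (w : ι → V) :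
    Nat.card {f : V →ₗ[K] V // ∀ i, f (s i) = w i} *
      Nat.card K ^ (Module.finrank K V * Fintype.card ι) =
      Nat.card K ^ (Module.finrank K V ^ 2) := by
  let φ : (V →ₗ[K] V) →ₗ[K] (ι → V) := LinearMap.pi fun i => LinearMap.applyₗ (s i)
  have hφ : Function.Surjective φ := fun w => by
    obtain ⟨f, hf⟩ := hs.exists_linearMap_apply_eq w
    exact ⟨f, funext hf⟩
  have h1 := Submodule.card_eq_card_quotient_mul_card (LinearMap.ker φ)
  rw [Nat.card_congr (φ.quotKerEquivOfSurjective hφ).toEquiv,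
    Module.natCard_eq_pow_finrank (K := K) (V := V →ₗ[K] V),
    Module.natCard_eq_pow_finrank (K := K) (V := ι → V), Module.finrank_linearMap,
    Module.finrank_pi_fintype, Finset.sum_const, Finset.card_univ, smul_eq_mul] at h1
  have e : {f : V →ₗ[K] V // ∀ i, f (s i) = w i} ≃ LinearMap.ker φ := by
    refine ((Equiv.subtypeEquivRight fun f => ?_).trans
      (AddMonoidHom.fiberEquivKerOfSurjective (f := φ.toAddMonoidHom) hφ w))
    exact (funext_iff (f := φ f) (g := w)).symm
  rw [Nat.card_congr e, mul_comm (Module.finrank K V), sq, h1, mul_comm]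

variable [Finite K]

lemma card_linearIndependent_family (ι : Type*) [Fintype ι] :
    (Nat.card {s : ι → V // LinearIndependent K s} : ℝ) =
      ∏ i ∈ Finset.range (Fintype.card ι),
        ((Nat.card K : ℝ) ^ Module.finrank K V - (Nat.card K : ℝ) ^ i) := by
  have := Fintype.ofFinite K
  have e : {s : ι → V // LinearIndependent K s} ≃
      {s : Fin (Fintype.card ι) → V // LinearIndependent K s} :=
    (Equiv.arrowCongr (Fintype.equivFin ι) (Equiv.refl V)).subtypeEquiv fun s =>
      (linearIndependent_equiv (Fintype.equivFin ι).symm (f := s)).symm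
  rw [Nat.card_congr e]
  rcases le_or_gt (Fintype.card ι) (Module.finrank K V) with h | h
  · rw [card_linearIndependent h, Finset.prod_range, Nat.cast_prod]
    refine Finset.prod_congr rfl fun i _ => ?_
    rw [Nat.cast_sub (Nat.pow_le_pow_right Fintype.card_pos (i.2.le.trans h)),
      Nat.card_eq_fintype_card]
    push_cast
    rfl
  -- Beyond the dimension both sides vanish, so no bound on the family size is required.
  · rw [Finset.prod_eq_zero (Finset.mem_range.2 h) (sub_self _), Nat.cast_eq_zero,
      Nat.card_eq_zero]
    refine Or.inl ⟨fun s => ?_⟩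
    have := s.2.fintype_card_le_finrank
    rw [Fintype.card_fin] at this
    omega

/-- An endomorphism with independent families in its eigenspaces is the same as an independent
family together with an endomorphism that acts on it by the prescribed scalars. -/
def sigmaEigenspaceFamilyEquiv (ι : K → Type*) :
    (Σ f : Module.End K V, ∀ a, {s : ι a → f.eigenspace a // LinearIndependent K s}) ≃
      Σ s : {s : (Σ a, ι a) → V // LinearIndependent K s},
        {f : V →ₗ[K] V // ∀ i, f (s.1 i) = i.1 • s.1 i} where
  toFun x := ⟨⟨fun i => (x.2 i.1).1 i.2,
      linearIndependent_sigma_eigenspace x.1 fun a => (x.2 a).2⟩,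
    ⟨x.1, fun i => Module.End.mem_eigenspace_iff.1 ((x.2 i.1).1 i.2).2⟩⟩
  invFun y := ⟨y.2.1, fun a => ⟨fun i => ⟨y.1.1 ⟨a, i⟩,
      Module.End.mem_eigenspace_iff.2 (y.2.2 ⟨a, i⟩)⟩,
    LinearIndependent.of_comp (Submodule.subtype _)
      (y.1.2.comp (fun i : ι a => (⟨a, i⟩ : Σ a, ι a)) sigma_mk_injective)⟩⟩
  left_inv _ := rfl
  right_inv _ := rfl

/-- Double counting: families chosen in distinct eigenspaces are jointly independent, so one may
choose the whole family first and then the endomorphism. -/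
lemma sum_prod_card_eigenspace_families [Fintype K] [Fintype (Module.End K V)] (k : K → ℕ) :
    ∑ f : Module.End K V, ∏ a : K, ∏ i ∈ Finset.range (k a),
        ((Nat.card K : ℝ) ^ Module.finrank K (f.eigenspace a) - (Nat.card K : ℝ) ^ i) =
      (Nat.card K : ℝ) ^ (Module.finrank K V ^ 2) *
        indepProb (Nat.card K) (Module.finrank K V) (∑ a, k a) := by
  have hK : (Nat.card K : ℝ) ≠ 0 := Nat.cast_ne_zero.2 Nat.card_pos.ne'
  have h1 := Nat.card_congr (sigmaEigenspaceFamilyEquiv (K := K) (V := V) fun a => Fin (k a))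
  have := Fintype.ofFinite {s : (Σ a, Fin (k a)) → V // LinearIndependent K s}
  rw [Nat.card_sigma, Nat.card_sigma] at h1
  have h2 : ∀ s : {s : (Σ a, Fin (k a)) → V // LinearIndependent K s},
      (Nat.card {f : V →ₗ[K] V // ∀ i, f (s.1 i) = i.1 • s.1 i} : ℝ) =
        (Nat.card K : ℝ) ^ (Module.finrank K V ^ 2) /
          (Nat.card K : ℝ) ^ (Module.finrank K V * ∑ a, k a) := fun s => by
    rw [eq_div_iff (pow_ne_zero _ hK)]
    have := card_linearMap_apply_eq s.2 (fun i => i.1 • s.1 i)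
    rw [Fintype.card_sigma] at this
    simp only [Fintype.card_fin] at this
    exact_mod_cast this
  have h3 := congrArg (Nat.cast (R := ℝ)) h1
  rw [Nat.cast_sum, Nat.cast_sum, Finset.sum_congr rfl fun s _ => h2 s, Finset.sum_const,
    Finset.card_univ, ← Nat.card_eq_fintype_card, nsmul_eq_mul,
    card_linearIndependent_family, Fintype.card_sigma] at h3
  simp only [Nat.card_pi, Nat.cast_prod, card_linearIndependent_family, Fintype.card_fin] at h3
  rw [h3, mul_div_assoc', mul_comm, mul_div_assoc, indepProb]
  congr 1
  rw [pow_mul, ← Finset.card_range (∑ a, k a), ← Finset.prod_const, Finset.card_range,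
    ← Finset.prod_div_distrib]
  exact Finset.prod_congr rfl fun i _ => by rw [sub_div, div_self (pow_ne_zero _ hK)]

lemma card_forall_eigenspace_eq_bot :
    (Nat.card {f : Module.End K V // ∀ a : K, f.eigenspace a = ⊥} : ℝ) =
      (Nat.card K : ℝ) ^ (Module.finrank K V ^ 2) *
        ∑ j ∈ Finset.range (Module.finrank K V + 1),
          indepProb (Nat.card K) (Module.finrank K V) j *
            PowerSeries.coeff j (eulerSeries (Nat.card K) ^ Nat.card K) := by
  classical
  have := Fintype.ofFinite K
  have : Finite (Module.End K V) := Module.finite_of_finite K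
  have := Fintype.ofFinite (Module.End K V)
  have hq : (1 : ℝ) < Nat.card K := by exact_mod_cast Finite.one_lt_card
  rw [Nat.card_eq_fintype_card, Fintype.card_subtype, Finset.card_filter, Nat.cast_sum,
    ← sum_piFinset_eulerCoeff hq, Finset.mul_sum]
  -- Each eigenspace has dimension at most `finrank K V`, so the truncated inversion formula applies
  -- to every factor.
  have h : ∀ f : Module.End K V, (((if ∀ a : K, f.eigenspace a = ⊥ then 1 else 0 : ℕ) : ℝ)) =
      ∑ k ∈ Fintype.piFinset fun _ : K => Finset.range (Module.finrank K V + 1),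
        (∏ a, eulerCoeff (Nat.card K) (k a)) * ∏ a, ∏ i ∈ Finset.range (k a),
          ((Nat.card K : ℝ) ^ Module.finrank K (f.eigenspace a) - (Nat.card K : ℝ) ^ i) := by
    intro f
    simp only [← Finset.prod_mul_distrib]
    rw [← Finset.prod_univ_sum (fun _ : K => Finset.range (Module.finrank K V + 1))
      (fun a k => eulerCoeff (Nat.card K) k * ∏ i ∈ Finset.range k,
        ((Nat.card K : ℝ) ^ Module.finrank K (f.eigenspace a) - (Nat.card K : ℝ) ^ i))]
    simp only [sum_eulerCoeff_mul_prod_pow hq (Submodule.finrank_le _),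
      Submodule.finrank_eq_zero, Finset.prod_ite_zero, Finset.prod_const_one, Finset.mem_univ,
      true_imp_iff]
    split_ifs <;> simp
  rw [Finset.sum_congr rfl fun f _ => h f, Finset.sum_comm]
  refine Finset.sum_congr rfl fun k _ => ?_
  rw [← Finset.mul_sum, sum_prod_card_eigenspace_families]
  ring

end LinearAlgebraCounting

lemma numSpectrumFree_eq (K : Type*) [Field K] [Finite K] (n : ℕ) :
    (numSpectrumFree K n : ℝ) = (Nat.card K : ℝ) ^ (n ^ 2) *
      ∑ j ∈ Finset.range (n + 1), indepProb (Nat.card K) n j *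
        PowerSeries.coeff j (eulerSeries (Nat.card K) ^ Nat.card K) := by
  have h := card_forall_eigenspace_eq_bot (K := K) (V := Fin n → K)
  rw [Module.finrank_fin_fun] at h
  rw [← h, numSpectrumFree, ← Nat.card_coe_set_eq]
  congr 1
  refine Nat.card_congr (Matrix.toLin'.toEquiv.subtypeEquiv fun M => forall_congr' fun a => ?_)
  rw [Module.End.hasEigenvalue_iff, not_not]
  rfl

/-! ### Codes, their bases and pencils of invertible matrices. -/

/-- Pairs of an independent family spanning a member of `S` correspond to the members of `S`
together with a basis. -/
def sigmaSpanningFamilyEquiv {K W : Type*} [Field K] [AddCommGroup W] [Module K W]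
    [FiniteDimensional K W] {k : ℕ} (S : Set (Submodule K W))
    (hS : ∀ C ∈ S, Module.finrank K C = k) :
    {v : Fin k → W // LinearIndependent K v ∧ Submodule.span K (Set.range v) ∈ S} ≃
      Σ C : S, {u : Fin k → C.1 // LinearIndependent K u} where
  toFun v := ⟨⟨_, v.2.2⟩, ⟨fun i => ⟨v.1 i, Submodule.subset_span ⟨i, rfl⟩⟩,
    LinearIndependent.of_comp (Submodule.subtype _) v.2.1⟩⟩
  invFun x := ⟨fun i => x.2.1 i, x.2.2.map' _ (Submodule.ker_subtype _), by
    have h1 : LinearIndependent K fun i => (x.2.1 i : W) :=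
      x.2.2.map' _ (Submodule.ker_subtype _)
    have h2 : Submodule.span K (Set.range fun i => (x.2.1 i : W)) = x.1.1 :=
      Submodule.eq_of_le_of_finrank_eq
        (Submodule.span_le.2 (Set.range_subset_iff.2 fun i => (x.2.1 i).2))
        (by rw [finrank_span_eq_card h1, hS _ x.1.2, Fintype.card_fin])
    rw [h2]
    exact x.1.2⟩
  left_inv _ := rfl
  right_inv x := by
    obtain ⟨⟨C, hC⟩, u, hu⟩ := x
    have h1 : LinearIndependent K fun i => (u i : W) := hu.map' _ (Submodule.ker_subtype _)
    have h2 : Submodule.span K (Set.range fun i => (u i : W)) = C :=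
      Submodule.eq_of_le_of_finrank_eq
        (Submodule.span_le.2 (Set.range_subset_iff.2 fun i => (u i).2))
        (by rw [finrank_span_eq_card h1, hS _ hC, Fintype.card_fin])
    -- The span equals `C` only propositionally; generalizing it to `D` allows substitution in the
    -- dependent pair.
    have h3 : ∀ (D : Submodule K W) (hD : D ∈ S) (w : Fin k → D) (hw : LinearIndependent K w),
        D = C → (∀ i, (w i : W) = u i) →
        (⟨⟨D, hD⟩, ⟨w, hw⟩⟩ : Σ C : S, {u : Fin k → C.1 // LinearIndependent K u}) =
          ⟨⟨C, hC⟩, ⟨u, hu⟩⟩ := by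
      rintro D hD w hw rfl h
      obtain rfl : w = u := funext fun i => Subtype.ext (h i)
      rfl
    exact h3 _ _ _ _ h2 fun _ => rfl

lemma Matrix.le_rank_iff_isUnit {K : Type*} [Field K] {n : ℕ} (M : Matrix (Fin n) (Fin n) K) :
    n ≤ M.rank ↔ IsUnit M := by
  refine ⟨fun h => ?_, fun h => by rw [Matrix.rank_of_isUnit M h, Fintype.card_fin]⟩
  rw [← Matrix.mulVec_surjective_iff_isUnit]
  have : LinearMap.range M.mulVecLin = ⊤ := Submodule.eq_top_of_finrank_eq
    (le_antisymm (Submodule.finrank_le _) (by rw [Module.finrank_fin_fun]; exact h))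
  exact LinearMap.range_eq_top.1 this

lemma mem_rankCodes_two_iff {K : Type*} [Field K] {n : ℕ}
    (C : Submodule K (Matrix (Fin n) (Fin n) K)) :
    C ∈ rankCodes K n n 2 n ↔ Module.finrank K C = 2 ∧ ∀ M ∈ C, M ≠ 0 → IsUnit M := by
  constructor
  · rintro ⟨-, h2, h3⟩
    exact ⟨h2, fun M hM h0 =>
      (Matrix.le_rank_iff_isUnit M).1 (h3.trans (Nat.sInf_le ⟨M, hM, h0, rfl⟩))⟩
  · rintro ⟨h2, h3⟩
    have hC : C ≠ ⊥ := by
      rintro rfl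
      simp at h2
    refine ⟨hC, h2, ?_⟩
    obtain ⟨M, hM, h0⟩ := Submodule.exists_mem_ne_zero_of_ne_bot hC
    refine le_csInf ⟨_, M, hM, h0, rfl⟩ ?_
    rintro _ ⟨N, hN, hN0, rfl⟩
    exact (Matrix.le_rank_iff_isUnit N).2 (h3 N hN hN0)

lemma forall_not_hasEigenvalue_iff {K : Type*} [Field K] {n : ℕ}
    (N : Matrix (Fin n) (Fin n) K) :
    (∀ a : K, ¬ Module.End.HasEigenvalue (Matrix.toLin' N) a) ↔
      ∀ a : K, IsUnit (N - a • (1 : Matrix (Fin n) (Fin n) K)) := by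
  refine forall_congr' fun a => ?_
  rw [Module.End.hasEigenvalue_iff, not_not, ← Matrix.mulVec_injective_iff_isUnit,
    Module.End.eigenspace_def]
  have : Matrix.toLin' N - a • (1 : Module.End K (Fin n → K)) =
      (N - a • (1 : Matrix (Fin n) (Fin n) K)).mulVecLin := by
    ext
    simp
  rw [this, LinearMap.ker_eq_bot]
  rfl

lemma linearIndependent_and_span_mem_rankCodes_iff {K : Type*} [Field K] {n : ℕ} [NeZero n]
    (v : Fin 2 → Matrix (Fin n) (Fin n) K) :
    (LinearIndependent K v ∧ Submodule.span K (Set.range v) ∈ rankCodes K n n 2 n) ↔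
      IsUnit (v 0) ∧ ∀ a : K, IsUnit (v 1 - a • v 0) := by
  obtain ⟨A, B, rfl⟩ : ∃ A B, v = ![A, B] := ⟨v 0, v 1, by ext i; fin_cases i <;> rfl⟩
  have hr : Set.range ![A, B] = {A, B} := by simp [Matrix.range_cons, Set.pair_comm]
  simp only [mem_rankCodes_two_iff, hr, Matrix.cons_val_zero, Matrix.cons_val_one]
  constructor
  · rintro ⟨hli, -, h⟩
    rw [LinearIndependent.pair_iff] at hli
    refine ⟨h A (Submodule.subset_span (by simp)) ?_,
      fun a => h _ (Submodule.mem_span_pair.2 ⟨-a, 1, by module⟩) ?_⟩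
    · rintro rfl
      simpa using hli 1 0 (by simp)
    · intro h0
      simpa using hli (-a) 1 (by rw [← h0]; module)
  · rintro ⟨hA, hB⟩
    -- Up to a non-zero scalar, every non-trivial combination is `A` or some `B - a • A`.
    have key : ∀ s t : K, ¬ (s = 0 ∧ t = 0) → IsUnit (s • A + t • B) := by
      intro s t hst
      by_cases ht : t = 0
      · have hs : s ≠ 0 := fun hs => hst ⟨hs, ht⟩
        rw [ht, zero_smul, add_zero]
        exact hA.smul (Units.mk0 s hs)
      · have h1 : s • A + t • B = (Units.mk0 t ht) • (B - (-(t⁻¹ * s)) • A) := by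
          rw [Units.smul_mk0, smul_sub, smul_smul, mul_neg, mul_inv_cancel_left₀ ht]
          module
        rw [h1]
        exact (hB _).smul _
    have hli : LinearIndependent K ![A, B] := LinearIndependent.pair_iff.2 fun s t h => by
      by_contra hst
      have := key s t hst
      rw [h] at this
      exact not_isUnit_zero this
    refine ⟨hli, ?_, fun M hM h0 => ?_⟩
    · have := finrank_span_eq_card hli
      rwa [hr, Fintype.card_fin] at this
    · obtain ⟨s, t, rfl⟩ := Submodule.mem_span_pair.1 hM
      refine key s t ?_
      rintro ⟨rfl, rfl⟩
      simp at h0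

/-- A pair `(A, B)` spanning a pencil of invertible matrices is determined by the invertible
matrix `A` and the spectrum-free matrix `A⁻¹ B`. -/
noncomputable def unitPencilEquiv (K : Type*) [Field K] (n : ℕ) :
    {v : Fin 2 → Matrix (Fin n) (Fin n) K // IsUnit (v 0) ∧ ∀ a : K, IsUnit (v 1 - a • v 0)} ≃
      (Matrix (Fin n) (Fin n) K)ˣ × {N : Matrix (Fin n) (Fin n) K |
        ∀ a : K, ¬ Module.End.HasEigenvalue (Matrix.toLin' N) a} := by
  refine Equiv.symm (Equiv.ofBijective (fun x => ⟨![x.1, x.1 * x.2.1], x.1.isUnit, fun a => ?_⟩)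
    ⟨?_, ?_⟩)
  · have h := (forall_not_hasEigenvalue_iff x.2.1).1 x.2.2 a
    have h1 := x.1.isUnit.mul h
    rwa [mul_sub, mul_smul_comm, mul_one] at h1
  · rintro ⟨A, N, hN⟩ ⟨A', N', hN'⟩ h
    have h0 := congrFun (congrArg Subtype.val h) 0
    have h1 := congrFun (congrArg Subtype.val h) 1
    simp only [Matrix.cons_val_zero, Matrix.cons_val_one] at h0 h1
    obtain rfl := Units.ext h0
    obtain rfl := A.isUnit.mul_left_cancel h1
    rfl
  · rintro ⟨v, ⟨A, hA⟩, hv⟩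
    have h2 : A.1 * (A⁻¹.1 * v 1) = v 1 := by rw [← mul_assoc, Units.mul_inv, one_mul]
    refine ⟨⟨A, A⁻¹.1 * v 1, (forall_not_hasEigenvalue_iff _).2 fun a => ?_⟩, ?_⟩
    · rw [← A.isUnit_units_mul, mul_sub, h2, mul_smul_comm, mul_one, hA]
      exact hv a
    · refine Subtype.ext (funext fun i => ?_)
      fin_cases i
      · exact hA
      · exact h2

/-- Both sides count ordered bases of codes: each code has `(q^2 - 1)(q^2 - q)` of them, and each
basis corresponds to a pair in `GL_n` times the spectrum-free matrices. -/
lemma ncard_rankCodes_two_mul (K : Type*) [Field K] [Finite K] (n : ℕ) [NeZero n] :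
    ((rankCodes K n n 2 n).ncard : ℝ) *
        (((Nat.card K : ℝ) ^ 2 - 1) * ((Nat.card K : ℝ) ^ 2 - Nat.card K)) =
      (numSpectrumFree K n : ℝ) *
        ∏ i ∈ Finset.range n, ((Nat.card K : ℝ) ^ n - (Nat.card K : ℝ) ^ i) := by
  have hS : ∀ C ∈ rankCodes K n n 2 n, Module.finrank K C = 2 := fun C hC => hC.2.1
  have h1 := Nat.card_congr ((sigmaSpanningFamilyEquiv _ hS).symm.trans
    ((Equiv.subtypeEquivRight linearIndependent_and_span_mem_rankCodes_iff).trans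
      (unitPencilEquiv K n)))
  have := Fintype.ofFinite (rankCodes K n n 2 n)
  have := Fintype.ofFinite K
  rw [Nat.card_sigma, Nat.card_prod, Nat.card_coe_set_eq, ← numSpectrumFree,
    Matrix.card_GL_field] at h1
  have h2 := congrArg (Nat.cast (R := ℝ)) h1
  have h3 : ∀ C : rankCodes K n n 2 n,
      (Nat.card {u : Fin 2 → C.1 // LinearIndependent K u} : ℝ) =
        ((Nat.card K : ℝ) ^ 2 - 1) * ((Nat.card K : ℝ) ^ 2 - Nat.card K) := fun C => by
    rw [card_linearIndependent_family, hS _ C.2, Fintype.card_fin, Finset.prod_range_succ,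
      Finset.prod_range_one, pow_zero, pow_one]
  rw [Nat.cast_sum, Finset.sum_congr rfl fun C _ => h3 C, Finset.sum_const, Finset.card_univ,
    ← Nat.card_eq_fintype_card, Nat.card_coe_set_eq, nsmul_eq_mul] at h2
  rw [h2, mul_comm, Nat.cast_mul, Nat.cast_prod, Finset.prod_range]
  congr 1
  refine Finset.prod_congr rfl fun i _ => ?_
  rw [Nat.cast_sub (Nat.pow_le_pow_right Fintype.card_pos i.2.le), Nat.card_eq_fintype_card]
  push_cast
  rfl

lemma rankDensity_two_eq (K : Type*) [Field K] [Finite K] {n : ℕ} (hn : 2 ≤ n) :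
    rankDensity K n n 2 n = ((numSpectrumFree K n : ℝ) *
        ∏ i ∈ Finset.range n, ((Nat.card K : ℝ) ^ n - (Nat.card K : ℝ) ^ i)) /
      (((Nat.card K : ℝ) ^ (n ^ 2) - 1) * ((Nat.card K : ℝ) ^ (n ^ 2) - Nat.card K)) := by
  have : NeZero n := ⟨by omega⟩
  have hq : (1 : ℝ) < Nat.card K := by exact_mod_cast Finite.one_lt_card
  have h1 := pow_succ_sub_one_pos hq 1
  have h2 : (0 : ℝ) < (Nat.card K : ℝ) ^ 2 - Nat.card K := by nlinarith
  rw [← ncard_rankCodes_two_mul, rankDensity, qBinom, Finset.prod_range_succ,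
    Finset.prod_range_one, pow_zero, pow_one, div_mul_div_comm, ← sq, div_div_eq_mul_div]

lemma rankDensity_two_eq_indepProb (K : Type*) [Field K] [Finite K] {n : ℕ} (hn : 2 ≤ n) :
    rankDensity K n n 2 n =
      ((∑ j ∈ Finset.range (n + 1), indepProb (Nat.card K) n j *
        PowerSeries.coeff j (eulerSeries (Nat.card K) ^ Nat.card K)) *
          indepProb (Nat.card K) n n) / indepProb (Nat.card K) (n ^ 2) 2 := by
  have hq : (Nat.card K : ℝ) ≠ 0 := Nat.cast_ne_zero.2 Nat.card_pos.ne'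
  have h1 : ∏ i ∈ Finset.range n, ((Nat.card K : ℝ) ^ n - (Nat.card K : ℝ) ^ i) =
      (Nat.card K : ℝ) ^ (n ^ 2) * indepProb (Nat.card K) n n := by
    have h0 : ((Nat.card K : ℝ) ^ n) ^ n = ∏ _i ∈ Finset.range n, (Nat.card K : ℝ) ^ n := by simp
    rw [indepProb, sq, pow_mul, h0, ← Finset.prod_mul_distrib]
    exact Finset.prod_congr rfl fun i _ => by
      rw [mul_sub, mul_one, mul_div_cancel₀ _ (pow_ne_zero _ hq)]
  have h2 : indepProb (Nat.card K) (n ^ 2) 2 =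
      (((Nat.card K : ℝ) ^ (n ^ 2) - 1) * ((Nat.card K : ℝ) ^ (n ^ 2) - Nat.card K)) /
        ((Nat.card K : ℝ) ^ (n ^ 2) * (Nat.card K : ℝ) ^ (n ^ 2)) := by
    rw [indepProb, Finset.prod_range_succ, Finset.prod_range_one, pow_zero, pow_one,
      mul_div_mul_comm, sub_div, sub_div, div_self (pow_ne_zero _ hq)]
  rw [rankDensity_two_eq K hn, numSpectrumFree_eq, h1, h2, div_div_eq_mul_div]
  ring

/-! ### The two limits of the density. -/

lemma indepProb_self {q : ℝ} (hq : 1 < q) (n : ℕ) :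
    indepProb q n n = ∏ i ∈ Finset.range n, (1 - 1 / q ^ (i + 1)) := by
  rw [indepProb, ← Finset.prod_range_reflect]
  refine Finset.prod_congr rfl fun i hi => ?_
  have hi := Finset.mem_range.1 hi
  have h : q ^ n = q ^ (n - 1 - i) * q ^ (i + 1) := by
    rw [← pow_add]
    congr 1
    omega
  have : q ≠ 0 := by linarith
  rw [h]
  field_simp

lemma tendsto_indepProb_of_tendsto {α : Type*} {l : Filter α} {q : α → ℝ}
    (hq : Tendsto q l atTop) {n j : ℕ} (h : j ≤ n) :
    Tendsto (fun x => indepProb (q x) n j) l (𝓝 1) := by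
  have : Tendsto (fun x => indepProb (q x) n j) l (𝓝 (∏ i ∈ Finset.range j, (1 - 0))) := by
    refine tendsto_finsetProd _ fun i hi => tendsto_const_nhds.sub ?_
    have hi : i < n := (Finset.mem_range.1 hi).trans_le h
    have h1 := ((tendsto_pow_atTop (Nat.sub_ne_zero_of_lt hi)).comp hq).inv_tendsto_atTop
    refine h1.congr' ?_
    filter_upwards [hq.eventually_gt_atTop 0] with x hx
    rw [Pi.inv_apply, Function.comp_apply, pow_sub₀ _ hx.ne' hi.le, mul_inv_rev, inv_inv,
      div_eq_mul_inv]
  simpa using this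

lemma multipliable_one_sub_one_div_pow {q : ℝ} (hq : 1 < q) :
    Multipliable fun i : ℕ => 1 - 1 / q ^ (i + 1) := by
  have h : Summable fun i : ℕ => -(1 / q ^ (i + 1)) := by
    have h1 := summable_geometric_of_lt_one (inv_nonneg.2 (zero_le_one.trans hq.le))
      (inv_lt_one_of_one_lt₀ hq)
    simpa using ((summable_nat_add_iff 1).2 h1).neg
  simpa [sub_eq_add_neg] using Real.multipliable_one_add_of_summable h

lemma tendsto_coe_primePow :
    Tendsto (fun q : {q : ℕ // IsPrimePow q} => ((q : ℕ) : ℝ)) atTop atTop := by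
  have : Nonempty {q : ℕ // IsPrimePow q} := ⟨⟨2, Nat.prime_two.isPrimePow⟩⟩
  refine tendsto_natCast_atTop_atTop.comp (tendsto_atTop_atTop.2 fun b => ?_)
  obtain ⟨p, hp, hpp⟩ := Nat.exists_infinite_primes b
  exact ⟨⟨p, hpp.isPrimePow⟩, fun q hq => hp.trans hq⟩

theorem theorem6p2 (F : {q : ℕ // IsPrimePow q} → Type*) [∀ q, Field (F q)] [∀ q, Finite (F q)]
    (hF : ∀ q, Nat.card (F q) = (q : ℕ)) :
    (∀ (q : {q : ℕ // IsPrimePow q}) (n : ℕ), 2 ≤ n →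
      rankDensity (F q) n n 2 n =
        ((numSpectrumFree (F q) n : ℝ) *
            ∏ i ∈ Finset.range n, (((q : ℕ) : ℝ) ^ n - ((q : ℕ) : ℝ) ^ i)) /
          ((((q : ℕ) : ℝ) ^ (n ^ 2) - 1) * (((q : ℕ) : ℝ) ^ (n ^ 2) - ((q : ℕ) : ℝ)))) ∧
    (∀ n : ℕ, 2 ≤ n →
      Tendsto (fun q : {q : ℕ // IsPrimePow q} => rankDensity (F q) n n 2 n) atTop
        (𝓝 (∑ i ∈ Finset.range (n + 1), (-1 : ℝ) ^ i / (i.factorial : ℝ)))) ∧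
    (∀ q : {q : ℕ // IsPrimePow q},
      Multipliable (fun i : ℕ => (1 - 1 / ((q : ℕ) : ℝ) ^ (i + 1)) ^ ((q : ℕ) + 1)) ∧
      Tendsto (fun n : ℕ => rankDensity (F q) n n 2 n) atTop
        (𝓝 (∏' i : ℕ, (1 - 1 / ((q : ℕ) : ℝ) ^ (i + 1)) ^ ((q : ℕ) + 1)))) := by
  refine ⟨fun q n hn => ?_, fun n hn => ?_, fun q => ?_⟩
  · rw [rankDensity_two_eq _ hn, hF]
  · simp_rw [rankDensity_two_eq_indepProb _ hn, hF]
    have hq := tendsto_coe_primePow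
    have h1 : Tendsto (fun q : {q : ℕ // IsPrimePow q} => ∑ j ∈ Finset.range (n + 1),
        indepProb (q : ℕ) n j * PowerSeries.coeff j (eulerSeries (q : ℕ) ^ (q : ℕ))) atTop
        (𝓝 (∑ j ∈ Finset.range (n + 1), 1 * ((-1 : ℝ) ^ j / (j.factorial : ℝ)))) :=
      tendsto_finsetSum _ fun j hj =>
        (tendsto_indepProb_of_tendsto hq (Nat.lt_succ_iff.1 (Finset.mem_range.1 hj))).mul
          (tendsto_coeff_eulerSeries_pow hq j)
    have h2 := (h1.mul (tendsto_indepProb_of_tendsto hq (le_refl n))).div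
      (tendsto_indepProb_of_tendsto hq (show 2 ≤ n ^ 2 by nlinarith)) one_ne_zero
    simp only [one_mul, mul_one, div_one] at h2
    exact h2
  · have hq : (1 : ℝ) < (q : ℕ) := by exact_mod_cast q.2.one_lt
    have hm := multipliable_one_sub_one_div_pow hq
    refine ⟨hm.pow _, ?_⟩
    have hE : ∑' k, eulerCoeff (q : ℕ) k = ∏' i : ℕ, (1 - 1 / ((q : ℕ) : ℝ) ^ (i + 1)) :=
      tendsto_nhds_unique (tendsto_prod_tsum_eulerCoeff hq) hm.hasProd.tendsto_prod_nat
    obtain ⟨hs, ht⟩ := eulerSeries_pow_summable hq (q : ℕ)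
    have h1 := tendsto_sum_indepProb_mul hq hs
    have h2 : Tendsto (fun n : ℕ => indepProb (q : ℕ) n n) atTop
        (𝓝 (∏' i : ℕ, (1 - 1 / ((q : ℕ) : ℝ) ^ (i + 1)))) := by
      simp_rw [indepProb_self hq]
      exact hm.hasProd.tendsto_prod_nat
    have h3 : Tendsto (fun n : ℕ => indepProb (q : ℕ) (n ^ 2) 2) atTop (𝓝 1) :=
      (tendsto_indepProb hq 2).comp (tendsto_pow_atTop two_ne_zero)
    have h4 := (h1.mul h2).div h3 one_ne_zero
    -- The exponent `q + 1`: `q` copies of `E(1)` from the eigenvalue conditions, one from `GL_n`.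
    rw [ht, hE, ← pow_succ, div_one, ← hm.tprod_pow] at h4
    refine h4.congr' ?_
    filter_upwards [eventually_ge_atTop 2] with n hn
    rw [rankDensity_two_eq_indepProb _ hn, hF]
    rfl
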